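/- Conventions. Let $(X,d)$ be a complete separable geodesic metric space, $|xy|=d(x,y)$; a constant-speed geodesic is $\xi:[0,1]\to X$ with $|\xi(s)\xi(t)|=|s-t|\,|\xi(0)\xi(1)|$ for all $s,t$. Let $S\ge1$, $C\ge0$, $D>0$. * $X$ is *$S$-concave* if $|p\xi(t)|^2\ge(1-t)|p\xi(0)|^2+t|p\xi(1)|^2-S\,t(1-t)|\xi(0)\xi(1)|^2$ for all $p\in X$, all constant-speed geodesics $\xi$ and all $t\in[0,1]$. * $X$ is *$(C,D)$-locally semi-convex* if $|p\xi(t)|^2\le(1-t)|p\xi(0)|^2+t|p\xi(1)|^2+C\,t(1-t)|\xi(0)\xi(1)|^2$ for all $t\in[0,1]$, all $p\in X$ and all constant-speed geodesics $\xi$ with $\sup_t|p\xi(t)|<D$. * $X$ is *Busemann concave* if for all constant-speed geodesics $\gamma,\eta$ with $\gamma(0)=\eta(0)$ the function $t\mapsto|\gamma(t)\eta(t)|/t$ is non-increasing on $(0,1]$. Write $\tilde\angle pxq$ for the angle at $\tilde x$ of the Euclidean triangle with side lengths $|px|,|qx|,|pq|$. For $0<\delta<1/2$, a point $p\ne x$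 is a *$(1,\delta)$-strainer at $x$ with opposite strainer $q\neq x$* if $\tilde\angle pxq>\pi-\delta$ and $\arccos\bigl(1-S\frac{|qx|}{2|px|}\bigr)<\delta$. Inductively, the empty tuple is a $(0,\delta)$-strainer at every point, and for $k\ge1$ a tuple $(p_1,\dots,p_k)$ is a *$(k,\delta)$-strainer at $x$* if $|p_1x|<D$, $(p_1,\dots,p_{k-1})$ is a $(k-1,\delta)$-strainer at $x$, $\arccos\bigl(1-(S+C)\frac{|p_kx|}{2|p_ix|}\bigr)<\delta$ for all $i<k$, and $p_k$ is a $(1,\delta)$-strainer at $x$ with some opposite strainer $q_k$ such that $|\tilde\angle p_ixp_k-\pi/2|<\delta$ and $|\tilde\angle p_ixq_k-\pi/2|<\delta$ for all $i<k$. Let $\mathcal A(k,\delta)$ be the set of points of $X$ at which some $(k,\delta)$-strainer exists; so $\mathcal A(0,\delta)=X$. (An inequality $\arccos(a)<\delta$ is understood to fail if $a<-1$.) Put $\delta_k=\frac{1}{k\,2^{2k+1}}$ for $k\ge1$. **Statement.** For every $\delta>0$ there is a constant $S_1=S_1(\delta)>1$ such that the following holds. Let $n\ge0$ be an integer with $\delta<\delta_{n+1}$,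 and let $X$ be a complete separable geodesic metric space of Hausdorff dimension $n$ that is Busemann concave, $S$-concave for some $S\in[1,S_1]$, and $(C,D)$-locally semi-convex for some $C\ge0$, $D>0$. Put $X_k=\mathcal A(k,\delta)\setminus\mathcal A(k+1,\delta)$ for $0\le k<n$ and $X_n=\mathcal A(n,\delta)$. Then $X$ is the disjoint union of $X_0,\dots,X_n$, and $\dim_H X_k\le k$ for every $k=0,\dots,n$. -/

import Mathlib

open Set

noncomputable section

namespace BusemannConcave

variable {X : Type*} [MetricSpace X]

/-- `ξ`, restricted to `[0,1]`, is a constant-speed (minimizing) geodesic. -/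
def IsConstSpeedGeodesic (ξ : ℝ → X) : Prop :=
  ∀ s ∈ Icc (0 : ℝ) 1, ∀ t ∈ Icc (0 : ℝ) 1, dist (ξ s) (ξ t) = |s - t| * dist (ξ 0) (ξ 1)

variable (X) in
/-- Any two points are joined by a geodesic. -/
def IsGeodesicSpace : Prop :=
  ∀ x y : X, ∃ ξ : ℝ → X, IsConstSpeedGeodesic ξ ∧ ξ 0 = x ∧ ξ 1 = y

variable (X) in
/-- The `S`-concavity inequality for squared distance functions along geodesics. -/
def IsSConcave (S : ℝ) : Prop :=
  ∀ (p : X) (ξ : ℝ → X), IsConstSpeedGeodesic ξ → ∀ t ∈ Icc (0 : ℝ) 1,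
    (1 - t) * dist p (ξ 0) ^ 2 + t * dist p (ξ 1) ^ 2 - S * t * (1 - t) * dist (ξ 0) (ξ 1) ^ 2
      ≤ dist p (ξ t) ^ 2

variable (X) in
/-- `(C, D)`-local semi-convexity. Since `ξ` is continuous on the compact interval `[0,1]`,
`sup_t |p ξ(t)| < D` is the same as `|p ξ(t)| < D` for all `t ∈ [0,1]`. -/
def IsLocallySemiConvex (C D : ℝ) : Prop :=
  ∀ (p : X) (ξ : ℝ → X), IsConstSpeedGeodesic ξ → (∀ t ∈ Icc (0 : ℝ) 1, dist p (ξ t) < D) →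
    ∀ t ∈ Icc (0 : ℝ) 1,
      dist p (ξ t) ^ 2 ≤ (1 - t) * dist p (ξ 0) ^ 2 + t * dist p (ξ 1) ^ 2
        + C * t * (1 - t) * dist (ξ 0) (ξ 1) ^ 2

variable (X) in
/-- Busemann concavity: `t ↦ |γ(t) η(t)| / t` is non-increasing (for `0 < t ≤ 1`) for geodesics
with a common starting point. -/
def IsBusemannConcave : Prop :=
  ∀ γ η : ℝ → X, IsConstSpeedGeodesic γ → IsConstSpeedGeodesic η → γ 0 = η 0 →
    AntitoneOn (fun t : ℝ => dist (γ t) (η t) / t) (Ioc 0 1)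

/-- The angle at the vertex `x` of the Euclidean comparison triangle with vertices `p, x, q`, by
the law of cosines. It is only used for `p ≠ x` and `q ≠ x`. -/
def compAngle (p x q : X) : ℝ :=
  Real.arccos ((dist p x ^ 2 + dist q x ^ 2 - dist p q ^ 2) / (2 * dist p x * dist q x))

/-- The error function `arccos (1 - K r / (2 t))`. Where `1 - K r / (2 t) < -1` the value is `π`,
so that a bound `errAngle K r t < δ` with `δ < 1/2` fails there. -/
def errAngle (K r t : ℝ) : ℝ :=
  Real.arccos (1 - K * r / (2 * t))

/-- `p` is a `(1,δ)`-strainer at `x` with opposite strainer `q`. -/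
def IsStrainerPair (S δ : ℝ) (p q x : X) : Prop :=
  p ≠ x ∧ q ≠ x ∧ Real.pi - δ < compAngle p x q ∧ errAngle S (dist q x) (dist p x) < δ

/-- `(p 0, …, p (k-1))` is a `(k,δ)`-strainer at `x`, for the parameters `S, C, D` of the space.
`Fin.init p` is the tuple `p` without its last entry; the empty tuple is a `(0,δ)`-strainer at
every point. -/
def IsStrainer (S C D δ : ℝ) : (k : ℕ) → (Fin k → X) → X → Prop
  | 0, _, _ => True
  | k + 1, p, x =>
      dist (p 0) x < D ∧
      IsStrainer S C D δ k (Fin.init p) x ∧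
      (∀ i : Fin k, errAngle (S + C) (dist (p (Fin.last k)) x) (dist (p i.castSucc) x) < δ) ∧
      ∃ q : X, IsStrainerPair S δ (p (Fin.last k)) q x ∧
        ∀ i : Fin k,
          |compAngle (p i.castSucc) x (p (Fin.last k)) - Real.pi / 2| < δ ∧
          |compAngle (p i.castSucc) x q - Real.pi / 2| < δ

variable (X) in
/-- The set `A(k,δ)` of `(k,δ)`-strained points. -/
def strainedSet (S C D : ℝ) (k : ℕ) (δ : ℝ) : Set X :=
  {x | ∃ p : Fin k → X, IsStrainer S C D δ k p x}

variable (X) in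
/-- The strata: `A(k,δ) \ A(k+1,δ)` for `k < n`, and `A(n,δ)` for `k = n`. -/
def stratum (S C D : ℝ) (n : ℕ) (δ : ℝ) (k : Fin (n + 1)) : Set X :=
  if (k : ℕ) < n then strainedSet X S C D k δ \ strainedSet X S C D (k + 1) δ
  else strainedSet X S C D n δ

/-- The threshold `δ_k = 1 / (k 2^(2k+1))`, for `k ≥ 1`. -/
def strainerThreshold (k : ℕ) : ℝ :=
  1 / ((k : ℝ) * 2 ^ (2 * k + 1))

end BusemannConcave

end

/-! Strained sets decrease in `k`, so the strata partition `X`, and the top one has dimension at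
most `n` trivially. Below the top, suppose `A(k,δ) \ A(k+1,δ)` has dimension above `k`. Then so does
each neighbourhood in it of some point, and one strainer `p` serves a whole such neighbourhood `V`.
Let `f = (|p_i ·|)_i`.

If near each `x ∈ V` the map `f` expands distances from `x` by a fixed factor, a countable
decomposition makes `f` locally antilipschitz, so `dim V ≤ k`. Otherwise points of `V` on which `f`
is almost constant accumulate at some `x`. Two of them, `y` and `z`, have `z` almost between `x` and
`y` and much nearer `x` (`exists_almost_between`). At `z`, the tuple `p` is extended by `y` with
opposite strainer `x` (`IsStrainer.snoc`), contradicting `z ∉ A(k+1,δ)`.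

Finding `y, z` needs doubling: Busemann contraction copies a large separated family into all smaller
scales, and the resulting Cantor set would have dimension above `n`. -/

open Filter Topology

/-! ### Dimension of separated trees -/

/-- A self-similar Cantor set with `N` pieces of ratio `ρ` at each level has dimension at least `d`
when `N ρ ^ d ≥ 1`. -/
theorem le_dimH_univ_of_separated_tree {X : Type*} [MetricSpace X] [CompleteSpace X] {N d : ℕ}
    (hN : 1 < N) (hd : 0 < d) {c : ℕ → (ℕ → Fin N) → X} {r ρ θ : ℝ} (hr : 0 < r) (hρ : 0 < ρ)
    (hρ₂ : ρ ≤ 1 / 2) (hρθ : ρ ≤ θ / 8)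
    (hstep : ∀ m ω, dist (c m ω) (c (m + 1) ω) ≤ r * ρ ^ m)
    (hsep : ∀ m ω ω', (∀ i < m, ω i = ω' i) → ω m ≠ ω' m →
      θ * (r * ρ ^ m) ≤ dist (c (m + 1) ω) (c (m + 1) ω'))
    (hNd : (ρ⁻¹) ^ d ≤ (N : ℝ)) : (d : ENNReal) ≤ dimH (univ : Set X) := by
  have hθ : 0 < θ := by linarith
  have hρ₁ : ρ < 1 := by linarith
  have hlim : ∀ ω, ∃ z, Tendsto (fun m => c m ω) atTop (𝓝 z) := fun ω =>
    cauchySeq_tendsto_of_complete (cauchySeq_of_le_geometric ρ r hρ₁ fun m => hstep m ω)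
  choose z hz using hlim
  have hcz : ∀ m ω, dist (c m ω) (z ω) ≤ 2 * (r * ρ ^ m) := fun m ω => by
    refine (dist_le_of_le_geometric_of_tendsto ρ r hρ₁ (fun m => hstep m ω) (hz ω) m).trans ?_
    rw [div_le_iff₀ (by linarith)]
    have : 0 < r * ρ ^ m := by positivity
    nlinarith
  -- Two tails of at most `2 r ρ ^ (m + 1) ≤ (θ / 4) r ρ ^ m` each cost half of the separation.
  have hzz : ∀ m ω ω', (∀ i < m, ω i = ω' i) → ω m ≠ ω' m →
      θ * (r * ρ ^ m) / 2 ≤ dist (z ω) (z ω') := fun m ω ω' h h' => by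
    have h1 := hcz (m + 1) ω
    have h2 := hcz (m + 1) ω'
    have h3 := hsep m ω ω' h h'
    have h4 := dist_triangle4 (c (m + 1) ω) (z ω) (z ω') (c (m + 1) ω')
    rw [dist_comm (z ω') (c (m + 1) ω')] at h4
    have h5 : r * ρ ^ (m + 1) ≤ θ / 8 * (r * ρ ^ m) := by
      rw [pow_succ, show r * (ρ ^ m * ρ) = ρ * (r * ρ ^ m) by ring]
      gcongr
    linarith
  have hdiff : ∀ ω ω' : ℕ → Fin N, ω ≠ ω' → ∃ m, (∀ i < m, ω i = ω' i) ∧ ω m ≠ ω' m := by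
    intro ω ω' h
    have h' : ∃ m, ω m ≠ ω' m := Function.ne_iff.1 h
    classical
    exact ⟨Nat.find h', fun i hi => not_not.1 (Nat.find_min h' hi), Nat.find_spec h'⟩
  have hinj : Function.Injective z := fun ω ω' h => by
    by_contra hne
    obtain ⟨m, hm, hm'⟩ := hdiff ω ω' hne
    have := hzz m ω ω' hm hm'
    rw [h, dist_self] at this
    have : 0 < θ * (r * ρ ^ m) / 2 := by positivity
    linarith
  have : NeZero N := ⟨by omega⟩
  -- Reading an address as base-`N` digits maps the Cantor set onto `[0,1]`. This is `d`-Hölder,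
  -- since addresses first differing at level `m` have images within `N ^ (-m) ≤ (ρ ^ m) ^ d`.
  let g : X → ℝ := fun x => Real.ofDigits (Function.invFun z x)
  have hg : ∀ ω, g (z ω) = Real.ofDigits ω := fun ω => by
    simp only [g, Function.leftInverse_invFun hinj ω]
  have hK : 0 < 2 / (θ * r) := by positivity
  have hdist : ∀ ω ω', dist (g (z ω)) (g (z ω')) ≤ (2 / (θ * r)) ^ d * dist (z ω) (z ω') ^ d := by
    intro ω ω'
    rcases eq_or_ne ω ω' with rfl | hne
    · rw [dist_self]; positivity
    obtain ⟨m, hm, hm'⟩ := hdiff ω ω' hne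
    rw [hg, hg, Real.dist_eq, ← mul_pow]
    refine (Real.abs_ofDigits_sub_ofDigits_le hm).trans ?_
    have h1 : ρ ^ m ≤ 2 / (θ * r) * dist (z ω) (z ω') := by
      have := hzz m ω ω' hm hm'
      rw [div_mul_eq_mul_div, le_div_iff₀ (by positivity)]
      linarith
    calc ((N : ℝ) ^ m)⁻¹ ≤ (((ρ⁻¹) ^ d) ^ m)⁻¹ := by gcongr
      _ = (ρ ^ m) ^ d := by rw [inv_pow, inv_pow, inv_inv, ← pow_mul, ← pow_mul, mul_comm]
      _ ≤ _ := by gcongr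
  have hholder : HolderOnWith (Real.toNNReal ((2 / (θ * r)) ^ d)) (d : NNReal) g (range z) := by
    rintro _ ⟨ω, rfl⟩ _ ⟨ω', rfl⟩
    rw [edist_dist, edist_dist, NNReal.coe_natCast, ENNReal.rpow_natCast,
      ← ENNReal.ofReal_pow dist_nonneg]
    change _ ≤ ENNReal.ofReal _ * _
    rw [← ENNReal.ofReal_mul (by positivity)]
    exact ENNReal.ofReal_le_ofReal (hdist ω ω')
  have h1 := hholder.dimH_image_le (by exact_mod_cast hd)
  have h2 : Icc (0 : ℝ) 1 ⊆ g '' range z := fun x hx => by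
    obtain ⟨ω, -, rfl⟩ := Real.ofDigits_SurjOn hN hx
    exact ⟨z ω, mem_range_self ω, hg ω⟩
  have h3 : (1 : ENNReal) ≤ dimH (g '' range z) := by
    refine le_trans (le_of_eq ?_) (dimH_mono h2)
    rw [Real.dimH_of_nonempty_interior (by rw [interior_Icc]; exact ⟨1 / 2, by norm_num⟩)]
    simp
  have h4 := h3.trans h1
  rw [ENNReal.le_div_iff_mul_le (by simp [hd.ne']) (by simp)] at h4
  simpa using h4.trans (dimH_mono (subset_univ _))

/-! ### Busemann contraction and doubling -/

namespace BusemannConcave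

theorem IsConstSpeedGeodesic.comp_mul {X : Type*} [MetricSpace X] {ξ : ℝ → X}
    (hξ : IsConstSpeedGeodesic ξ) {t : ℝ} (ht : t ∈ Icc (0 : ℝ) 1) :
    IsConstSpeedGeodesic fun s => ξ (s * t) := by
  have hmem : ∀ s ∈ Icc (0 : ℝ) 1, s * t ∈ Icc (0 : ℝ) 1 := fun s hs =>
    ⟨mul_nonneg hs.1 ht.1, mul_le_one₀ hs.2 ht.1 ht.2⟩
  intro s hs s' hs'
  simp only
  rw [hξ _ (hmem s hs) _ (hmem s' hs'), hξ _ (hmem 0 (by simp)) _ (hmem 1 (by simp)), ← sub_mul,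
    ← sub_mul, abs_mul, abs_mul, zero_sub, abs_neg, abs_one]
  ring

theorem IsConstSpeedGeodesic.dist_zero {X : Type*} [MetricSpace X] {ξ : ℝ → X}
    (hξ : IsConstSpeedGeodesic ξ) {t : ℝ} (ht : t ∈ Icc (0 : ℝ) 1) :
    dist (ξ 0) (ξ t) = t * dist (ξ 0) (ξ 1) := by
  rw [hξ 0 (by simp) t ht, zero_sub, abs_neg, abs_of_nonneg ht.1]

theorem IsConstSpeedGeodesic.dist_one {X : Type*} [MetricSpace X] {ξ : ℝ → X}
    (hξ : IsConstSpeedGeodesic ξ) {t : ℝ} (ht : t ∈ Icc (0 : ℝ) 1) :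
    dist (ξ t) (ξ 1) = (1 - t) * dist (ξ 0) (ξ 1) := by
  rw [hξ t ht 1 (by simp), abs_sub_comm, abs_of_nonneg (by linarith [ht.2])]

theorem IsBusemannConcave.mul_dist_le {X : Type*} [MetricSpace X] (hB : IsBusemannConcave X)
    {γ η : ℝ → X} (hγ : IsConstSpeedGeodesic γ) (hη : IsConstSpeedGeodesic η) (h : γ 0 = η 0)
    {t : ℝ} (ht : t ∈ Ioc (0 : ℝ) 1) : t * dist (γ 1) (η 1) ≤ dist (γ t) (η t) := by
  have := hB γ η hγ hη h ht (by simp) ht.2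
  simp only [div_one] at this
  rwa [le_div_iff₀ ht.1, mul_comm] at this

/-- Contraction towards a point carries separated families to separated families of a smaller
scale. -/
theorem exists_separated_of_le {X : Type*} [MetricSpace X] (hG : IsGeodesicSpace X)
    (hB : IsBusemannConcave X) {ι : Type*} {x : X} {u : ι → X} {η s s' : ℝ} (hs' : 0 < s')
    (hss' : s' ≤ s) (hx : ∀ i, dist x (u i) ≤ s) (hu : ∀ i j, i ≠ j → η * s ≤ dist (u i) (u j)) :
    ∃ v : ι → X, (∀ i, dist x (v i) ≤ s') ∧ ∀ i j, i ≠ j → η * s' ≤ dist (v i) (v j) := by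
  have hs : 0 < s := hs'.trans_le hss'
  choose γ hγ h0 h1 using fun i => hG x (u i)
  have ht : s' / s ∈ Ioc (0 : ℝ) 1 := ⟨by positivity, (div_le_one hs).2 hss'⟩
  refine ⟨fun i => γ i (s' / s), fun i => ?_, fun i j hij => ?_⟩
  · have := (hγ i).dist_zero (Ioc_subset_Icc_self ht)
    rw [h0, h1] at this
    rw [this, div_mul_eq_mul_div, div_le_iff₀ hs]
    exact mul_le_mul_of_nonneg_left (hx i) hs'.le
  · refine le_trans ?_ (hB.mul_dist_le (hγ i) (hγ j) ((h0 i).trans (h0 j).symm) ht)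
    rw [h1, h1, div_mul_eq_mul_div, le_div_iff₀ hs]
    nlinarith [hu i j hij]

/-- A complete Busemann concave space of finite Hausdorff dimension is uniformly doubling. -/
theorem exists_packing_bound {X : Type*} [MetricSpace X] [CompleteSpace X]
    (hG : IsGeodesicSpace X) (hB : IsBusemannConcave X) {n : ℕ}
    (hn : dimH (univ : Set X) ≤ (n : ENNReal)) {η : ℝ} (hη : 0 < η) :
    ∃ N : ℕ, 0 < N ∧ ∀ (x : X) (s : ℝ), 0 < s → ∀ u : Fin N → X, (∀ i, dist x (u i) ≤ s) →
      ∃ i j, i ≠ j ∧ dist (u i) (u j) < η * s := by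
  -- The factor `1 / 2` pays for recentring: around another point of the ball, the family `u` only
  -- fits in radius `2 * s`.
  set θ : ℝ := min (η / 2) 1 with hθdef
  have hθ : 0 < θ := by positivity
  have hθη : θ ≤ η / 2 := min_le_left _ _
  have hθ1 : θ ≤ 1 := min_le_right _ _
  set ρ : ℝ := θ / 8 with hρdef
  have hρ : 0 < ρ := by positivity
  have hρ₂ : ρ ≤ 1 / 2 := by linarith
  have hN1 : (1 : ℝ) < (ρ⁻¹) ^ (n + 1) := one_lt_pow₀ ((one_lt_inv₀ hρ).2 (by linarith)) (by omega)
  have hN : (ρ⁻¹) ^ (n + 1) ≤ (⌈(ρ⁻¹) ^ (n + 1)⌉₊ : ℝ) := Nat.le_ceil _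
  set N : ℕ := ⌈(ρ⁻¹) ^ (n + 1)⌉₊
  have hN1' : 1 < N := by exact_mod_cast hN1.trans_le hN
  refine ⟨N, by omega, fun x s hs u hx => ?_⟩
  by_contra! hu
  have H : ∀ (y : X) (s' : ℝ), dist x y ≤ s → 0 < s' → s' ≤ 2 * s → ∃ v : Fin N → X,
      (∀ i, dist y (v i) ≤ s') ∧ ∀ i j, i ≠ j → θ * s' ≤ dist (v i) (v j) := by
    intro y s' hy h0 hs'
    refine exists_separated_of_le hG hB h0 hs' (u := u) (fun i => ?_) fun i j hij => ?_
    · linarith [dist_triangle_left y (u i) x, hx i]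
    · nlinarith [hu i j hij]
  choose! v hv hv' using H
  -- The steps `r * ρ ^ m` sum to at most `2 * r = s`, so all tree vertices stay in the ball where
  -- `H` applies.
  set r : ℝ := s / 2 with hr
  let c : ℕ → (ℕ → Fin N) → X := fun m ω => Nat.rec x (fun m y => v y (r * ρ ^ m) (ω m)) m
  have hc0 : ∀ ω, c 0 ω = x := fun _ => rfl
  have hcs : ∀ m ω, c (m + 1) ω = v (c m ω) (r * ρ ^ m) (ω m) := fun _ _ => rfl
  have hrm : ∀ m : ℕ, 0 < r * ρ ^ m ∧ r * ρ ^ m ≤ 2 * s := fun m => by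
    have : ρ ^ m ≤ 1 := pow_le_one₀ hρ.le (by linarith)
    exact ⟨by positivity, by nlinarith⟩
  have hc : ∀ m ω, dist x (c m ω) ≤ 2 * r * (1 - ρ ^ m) := fun m ω => by
    induction m with
    | zero => simp [hc0]
    | succ m ih =>
      have h0 : 0 < r * ρ ^ m := (hrm m).1
      have h1 := hv (c m ω) _ (by nlinarith) (hrm m).1 (hrm m).2 (ω m)
      rw [← hcs] at h1
      have h2 := dist_triangle x (c m ω) (c (m + 1) ω)
      have h3 : r * ρ ^ m * ρ ≤ r * ρ ^ m * (1 / 2) := by gcongr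
      rw [pow_succ]
      linarith
  have hc' : ∀ m ω, dist x (c m ω) ≤ s := fun m ω => by
    have := (hrm m).1
    linarith [hc m ω]
  have hdep : ∀ m ω ω', (∀ i < m, ω i = ω' i) → c m ω = c m ω' := by
    intro m ω ω' h
    induction m with
    | zero => rfl
    | succ m ih => rw [hcs, hcs, ih fun i hi => h i (by omega), h m (by omega)]
  have := le_dimH_univ_of_separated_tree (d := n + 1) hN1' (by omega) (c := c) (r := r) (θ := θ)
    (by positivity) hρ hρ₂ le_rfl (fun m ω => hv _ _ (hc' m ω) (hrm m).1 (hrm m).2 _)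
    (fun m ω ω' h h' => by
      rw [hcs, hcs, hdep m ω ω' h]
      exact hv' _ _ (hc' m ω') (hrm m).1 (hrm m).2 _ _ h') hN
  have := this.trans hn
  norm_cast at this
  omega

/-- Near a point of accumulation `x` of `Y` there are `y, z ∈ Y` such that `z` lies almost on a
geodesic from `x` to `y`, much closer to `x` than to `y`. -/
theorem exists_almost_between {X : Type*} [MetricSpace X] [CompleteSpace X]
    (hG : IsGeodesicSpace X) (hB : IsBusemannConcave X) {n : ℕ}
    (hn : dimH (univ : Set X) ≤ (n : ENNReal)) {ε c : ℝ} (hε : 0 < ε) (hc : 0 < c) {x : X}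
    {Y : Set X} (hY : ∀ r > 0, ∃ y ∈ Y, y ≠ x ∧ dist x y < r) :
    ∃ y ∈ Y, ∃ z ∈ Y, y ≠ x ∧ z ≠ x ∧ dist x z ≤ c * dist x y ∧
      dist y z ≤ dist x y - (1 - ε) * dist x z := by
  obtain ⟨N, hN0, hN⟩ := exists_packing_bound hG hB hn hε
  by_contra! hcon
  -- A sequence in `Y` approaching `x` fast enough that every later point is `c` times closer than
  -- any earlier one.
  obtain ⟨f, hf⟩ : ∃ f : ℕ → X, ∀ m, (f m ∈ Y ∧ f m ≠ x) ∧
      dist x (f (m + 1)) < min c 1 * dist x (f m) := by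
    have step : ∀ y : {y : X // y ∈ Y ∧ y ≠ x}, ∃ z : {y : X // y ∈ Y ∧ y ≠ x},
        dist x z < min c 1 * dist x y := fun ⟨y, hy, hyx⟩ => by
      have := dist_pos.2 hyx.symm
      obtain ⟨z, hz, hzx, h⟩ := hY (min c 1 * dist x y) (by positivity)
      exact ⟨⟨z, hz, hzx⟩, h⟩
    choose g hg using step
    obtain ⟨y, hy, hyx, -⟩ := hY 1 one_pos
    refine ⟨fun m => (g^[m] ⟨y, hy, hyx⟩ : {y : X // y ∈ Y ∧ y ≠ x}), fun m =>
      ⟨(g^[m] ⟨y, hy, hyx⟩).2, ?_⟩⟩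
    simp only [Function.iterate_succ_apply']
    exact hg _
  have hpos : ∀ m, 0 < dist x (f m) := fun m => dist_pos.2 (hf m).1.2.symm
  have hanti : Antitone fun m => dist x (f m) := antitone_nat_of_succ_le fun m => by
    have := (hf m).2
    have h1 : min c 1 * dist x (f m) ≤ 1 * dist x (f m) := by
      have := hpos m
      gcongr
      exact min_le_right _ _
    linarith
  have hlt : ∀ i j, i < j → dist x (f j) ≤ c * dist x (f i) := fun i j hij => by
    have h1 : dist x (f j) ≤ dist x (f (i + 1)) := hanti hij
    have h2 := (hf i).2
    have h3 : min c 1 * dist x (f i) ≤ c * dist x (f i) := by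
      have := hpos i
      gcongr
      exact min_le_left _ _
    linarith
  choose γ hγ h0 h1 using fun m => hG x (f m)
  -- The points `f 0, …, f (N - 1)` are pulled back to the common radius `s`. Failure of betweenness
  -- keeps the pulled-back points `ε * s`-separated, against the packing bound.
  set s := dist x (f N) with hs
  have hsi : ∀ i : Fin N, s / dist x (f i) ∈ Ioc (0 : ℝ) 1 := fun i =>
    ⟨div_pos (hpos _) (hpos _), (div_le_one (hpos _)).2 (hanti i.2.le)⟩
  have key : ∀ i j : Fin N, i < j →
      ε * s ≤ dist (γ i (s / dist x (f i))) (γ j (s / dist x (f j))) := by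
    intro i j hij
    have hi := hpos i
    have hj := hpos j
    have ht : dist x (f j) / dist x (f i) ∈ Icc (0 : ℝ) 1 :=
      ⟨by positivity, (div_le_one hi).2 (hanti (by exact_mod_cast hij.le))⟩
    have h2 := hcon _ (hf i).1.1 _ (hf j).1.1 (hf i).1.2 (hf j).1.2 (hlt i j (by exact_mod_cast hij))
    have h3 := (hγ i).dist_one ht
    have h4 := dist_triangle_left (f i) (f j) (γ i (dist x (f j) / dist x (f i)))
    rw [h0, h1, sub_mul, div_mul_cancel₀ _ hi.ne', one_mul] at h3
    have h5 := hB.mul_dist_le ((hγ i).comp_mul ht) (hγ j) (by simp [h0]) (hsi j)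
    rw [one_mul, h1, div_mul_div_cancel₀ hj.ne', div_mul_eq_mul_div, div_le_iff₀ hj] at h5
    have h6 : 0 < s := hpos N
    have h7 : ε * dist x (f j) ≤ dist (γ i (dist x (f j) / dist x (f i))) (f j) := by linarith
    have h8 := mul_le_mul_of_nonneg_left h7 h6.le
    nlinarith
  obtain ⟨i, j, hij, h⟩ := hN x s (hpos N) (fun i => γ i (s / dist x (f i))) fun i => by
    have := (hγ i).dist_zero (Ioc_subset_Icc_self (hsi i))
    rw [h0, h1, div_mul_cancel₀ _ (hpos _).ne'] at this
    exact this.le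
  rcases lt_or_gt_of_ne hij with hij | hij
  · exact absurd (key i j hij) (not_le.2 h)
  · rw [dist_comm] at h
    exact absurd (key j i hij) (not_le.2 h)

end BusemannConcave

/-! ### Dimension bound from expanding maps -/

/-- A set on which `f` expands distances from each point, in a neighbourhood depending on that
point, has at most the dimension of the target. -/
theorem dimH_le_of_expanding_at_points {X : Type*} [MetricSpace X] [SecondCountableTopology X]
    {k : ℕ} {f : X → Fin k → ℝ} {V : Set X} {σ : ℝ} (hσ : 0 < σ)
    (h : ∀ x ∈ V, ∃ r > 0, ∀ y ∈ V, dist x y < r → σ * dist x y ≤ dist (f x) (f y)) :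
    dimH V ≤ (k : ENNReal) := by
  -- Points where the radius `1 / (m + 1)` works; inside a ball of half that radius every pair of
  -- them is expanded.
  let W : ℕ → Set X := fun m =>
    {x ∈ V | ∀ y ∈ V, dist x y < 1 / (m + 1 : ℝ) → σ * dist x y ≤ dist (f x) (f y)}
  have hVW : V ⊆ ⋃ m, W m := fun x hx => by
    obtain ⟨r, hr, hxr⟩ := h x hx
    obtain ⟨m, hm⟩ := exists_nat_one_div_lt hr
    exact mem_iUnion.2 ⟨m, hx, fun y hy hxy => hxr y hy (hxy.trans hm)⟩
  refine (dimH_mono hVW).trans ?_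
  rw [dimH_iUnion]
  refine iSup_le fun m => ?_
  by_contra! hlt
  obtain ⟨x, -, hx⟩ := exists_mem_nhdsWithin_lt_dimH_of_lt_dimH hlt
  have hm : (0 : ℝ) < 1 / (m + 1 : ℝ) / 2 := by positivity
  let B : Set X := W m ∩ Metric.ball x (1 / (m + 1 : ℝ) / 2)
  refine absurd (hx B (inter_mem self_mem_nhdsWithin
    (mem_nhdsWithin_of_mem_nhds (Metric.ball_mem_nhds x hm)))) (not_lt.2 ?_)
  have hanti : AntilipschitzWith (Real.toNNReal σ⁻¹) (fun y : B => f y) := by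
    refine AntilipschitzWith.of_le_mul_dist fun y z => ?_
    have hyz := y.2.1.2 z z.2.1.1 (by
      have hy := Metric.mem_ball.1 y.2.2
      have hz := Metric.mem_ball.1 z.2.2
      linarith [dist_triangle_right (y : X) z x])
    rw [Real.coe_toNNReal _ (by positivity), inv_mul_eq_div, le_div_iff₀ hσ, mul_comm]
    exact hyz
  have h1 := (hanti.le_dimH_image univ).trans (dimH_mono (subset_univ _))
  rw [Real.dimH_univ_pi_fin] at h1
  rwa [← (isometry_subtype_coe (s := B)).dimH_image, image_univ, Subtype.range_coe] at h1

/-! ### Comparison angles and strainers -/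

namespace BusemannConcave

theorem arccos_lt_of_cos_lt {v δ : ℝ} (hδ : 0 < δ) (hδπ : δ ≤ Real.pi) (h : Real.cos δ < v) :
    Real.arccos v < δ := by
  have := (Real.lt_arcsin_iff_sin_lt' (x := Real.pi / 2 - δ) (y := v)
    ⟨by linarith, by linarith⟩).2 (by rwa [Real.sin_pi_div_two_sub])
  rw [Real.arccos]
  linarith

theorem pi_sub_lt_arccos_of_lt {v δ : ℝ} (hδ : 0 < δ) (hδπ : δ ≤ Real.pi)
    (h : v < -Real.cos δ) : Real.pi - δ < Real.arccos v := by
  have := arccos_lt_of_cos_lt hδ hδπ (lt_neg.1 h)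
  rw [Real.arccos_neg] at this
  linarith

theorem abs_arccos_sub_pi_div_two_lt {v δ : ℝ} (hδ : 0 < δ) (hδπ : δ < Real.pi / 2)
    (h : |v| < Real.sin δ) : |Real.arccos v - Real.pi / 2| < δ := by
  rw [abs_lt] at h
  have h1 := (Real.arcsin_lt_iff_lt_sin' (x := v) (y := δ) ⟨by linarith, hδπ.le⟩).2 h.2
  have h2 := (Real.lt_arcsin_iff_sin_lt' (x := -δ) (y := v) ⟨by linarith, by linarith⟩).2
    (by rw [Real.sin_neg]; exact h.1)
  rw [Real.arccos, abs_lt]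
  constructor <;> linarith

theorem errAngle_lt {K r t δ : ℝ} (hδ : 0 < δ) (hδπ : δ ≤ Real.pi) (ht : 0 < t)
    (h : K * r < (1 - Real.cos δ) * (2 * t)) : errAngle K r t < δ := by
  refine arccos_lt_of_cos_lt hδ hδπ ?_
  have := (div_lt_iff₀ (by positivity)).2 h
  linarith

variable {X : Type*} [MetricSpace X]

/-- The comparison angle at `z` is almost right if `q` is close to `z` compared with `p`, and
`p` is at almost the same distance from `q` and `z`. -/
theorem abs_compAngle_sub_lt {p z q : X} {τ δ : ℝ} (hδ : 0 < δ) (hδπ : δ < Real.pi / 2)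
    (hτ1 : τ ≤ 1) (hτδ : 5 * τ < Real.sin δ) (hp : p ≠ z) (hq : q ≠ z)
    (hqz : dist q z ≤ τ * dist p z) (hpq : |dist p z - dist p q| ≤ 3 * τ * dist q z) :
    |compAngle p z q - Real.pi / 2| < δ := by
  refine abs_arccos_sub_pi_div_two_lt hδ hδπ (lt_of_le_of_lt ?_ hτδ)
  have hA : 0 < dist p z := dist_pos.2 hp
  have ha : 0 < dist q z := dist_pos.2 hq
  have hB : dist p q ≤ dist p z + dist q z := dist_triangle_right p q z
  have hB0 : 0 ≤ dist p q := dist_nonneg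
  generalize dist p z = A at *
  generalize dist q z = a at *
  generalize dist p q = B at *
  have h1 : a ≤ A := hqz.trans (by nlinarith)
  rw [abs_div, abs_of_pos (show 0 < 2 * A * a by positivity), div_le_iff₀ (by positivity)]
  calc |A ^ 2 + a ^ 2 - B ^ 2| = |(A - B) * (A + B) + a * a| := by ring_nf
    _ ≤ |A - B| * (A + B) + a * a := by
      refine (abs_add_le _ _).trans (le_of_eq ?_)
      rw [abs_mul, abs_mul, abs_of_pos (show 0 < A + B by linarith), abs_of_pos ha]
    _ ≤ (3 * τ * a) * (3 * A) + a * (τ * A) := by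
      have : 0 ≤ 3 * τ * a := (abs_nonneg _).trans hpq
      gcongr
      linarith
    _ = 5 * τ * (2 * A * a) := by ring

/-- If `z` lies almost between `x` and `y`, the comparison angle at `z` is almost `π`. -/
theorem pi_sub_lt_compAngle {x y z : X} {τ δ : ℝ} (hδ : 0 < δ) (hδπ : δ ≤ Real.pi) (hτ : 0 ≤ τ)
    (hτ1 : τ ≤ 1) (hτδ : 2 * τ < 1 - Real.cos δ) (hy : y ≠ z) (hx : x ≠ z)
    (hxy : dist x z ≤ dist y z) (h : dist y z + (1 - τ) * dist x z ≤ dist y x) :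
    Real.pi - δ < compAngle y z x := by
  refine pi_sub_lt_arccos_of_lt hδ hδπ (lt_of_le_of_lt ?_ (show -1 + 2 * τ < _ by linarith))
  have ha : 0 < dist y z := dist_pos.2 hy
  have hb : 0 < dist x z := dist_pos.2 hx
  generalize dist y z = a at *
  generalize dist x z = b at *
  generalize dist y x = e at *
  rw [div_le_iff₀ (by positivity)]
  have h0 : 0 ≤ (1 - τ) * b := mul_nonneg (by linarith) hb.le
  have h1 : (a + (1 - τ) * b) ^ 2 ≤ e ^ 2 := by gcongr
  have h2 : τ * (b * b) ≤ τ * (a * b) := by gcongr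
  nlinarith [mul_nonneg (mul_nonneg hτ hτ) (mul_nonneg hb.le hb.le)]

theorem IsStrainer.ne {S C D δ : ℝ} : ∀ {k : ℕ} {p : Fin k → X} {x : X},
    IsStrainer S C D δ k p x → ∀ i, p i ≠ x
  | 0, _, _, _ => fun i => i.elim0
  | k + 1, p, x, ⟨_, h, _, _, hq, _⟩ => fun i => by
    induction i using Fin.lastCases with
    | last => exact hq.1
    | cast i => exact IsStrainer.ne h i

theorem continuousAt_compAngle {p q x : X} (hp : p ≠ x) (hq : q ≠ x) :
    ContinuousAt (fun z => compAngle p z q) x := by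
  refine Real.continuous_arccos.continuousAt.comp (ContinuousAt.div (by fun_prop) (by fun_prop) ?_)
  have := dist_pos.2 hp
  have := dist_pos.2 hq
  positivity

theorem continuousAt_errAngle {K : ℝ} {p q x : X} (hp : p ≠ x) :
    ContinuousAt (fun z => errAngle K (dist q z) (dist p z)) x := by
  refine Real.continuous_arccos.continuousAt.comp
    (continuousAt_const.sub (ContinuousAt.div (by fun_prop) (by fun_prop) ?_))
  have := dist_pos.2 hp
  positivity

/-- All defining inequalities are strict and continuous in the base point away from the strainers,
and the same opposite strainers can be kept. -/
theorem IsStrainer.eventually {S C D δ : ℝ} : ∀ {k : ℕ} {p : Fin k → X} {x : X},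
    IsStrainer S C D δ k p x → ∀ᶠ z in 𝓝 x, IsStrainer S C D δ k p z
  | 0, _, _, _ => Eventually.of_forall fun _ => trivial
  | k + 1, p, x, hs@⟨hD, h, herr, q, ⟨hp, hq, hpq, hpq'⟩, hang⟩ => by
    have hi : ∀ i : Fin k, p i.castSucc ≠ x := fun i => hs.ne _
    have e1 : ∀ᶠ z in 𝓝 x, dist (p 0) z < D :=
      ContinuousAt.eventually_lt (by fun_prop) (by fun_prop) hD
    have e2 := h.eventually
    have e3 : ∀ᶠ z in 𝓝 x, ∀ i : Fin k,
        errAngle (S + C) (dist (p (Fin.last k)) z) (dist (p i.castSucc) z) < δ :=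
      eventually_all.2 fun i => (continuousAt_errAngle (hi i)).eventually_lt continuousAt_const
        (herr i)
    have e4 : ∀ᶠ z in 𝓝 x, Real.pi - δ < compAngle (p (Fin.last k)) z q :=
      continuousAt_const.eventually_lt (continuousAt_compAngle hp hq) hpq
    have e5 : ∀ᶠ z in 𝓝 x, errAngle S (dist q z) (dist (p (Fin.last k)) z) < δ :=
      (continuousAt_errAngle hp).eventually_lt continuousAt_const hpq'
    have e6 : ∀ᶠ z in 𝓝 x, ∀ i : Fin k,
        |compAngle (p i.castSucc) z (p (Fin.last k)) - Real.pi / 2| < δ ∧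
        |compAngle (p i.castSucc) z q - Real.pi / 2| < δ :=
      eventually_all.2 fun i =>
        (((continuousAt_compAngle (hi i) hp).sub continuousAt_const).abs.eventually_lt
          continuousAt_const (hang i).1).and
        (((continuousAt_compAngle (hi i) hq).sub continuousAt_const).abs.eventually_lt
          continuousAt_const (hang i).2)
    filter_upwards [e1, e2, e3, e4, e5, e6, isOpen_ne.mem_nhds hp.symm, isOpen_ne.mem_nhds hq.symm]
      with z h1 h2 h3 h4 h5 h6 h7 h8
    exact ⟨h1, h2, h3, q, ⟨h7.symm, h8.symm, h4, h5⟩, h6⟩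

/-- A strainer at `z` is extended by `y`, with opposite strainer `x`, if `z` is almost between
`x` and `y`, much closer to `x`, and the points are at almost the same distances from the
strainer. -/
theorem IsStrainer.snoc {S C D δ τ : ℝ} {k : ℕ} {p : Fin k → X} {x y z : X}
    (hp : IsStrainer S C D δ k p z) (hδ : 0 < δ) (hδπ : δ < Real.pi / 2) (hτ : 0 ≤ τ) (hτ1 : τ ≤ 1)
    (hτs : 5 * τ < Real.sin δ) (hτc : 2 * τ < 1 - Real.cos δ) (hy : y ≠ z) (hx : x ≠ z)
    (hD : dist y z < D) (hSC : ∀ i, (S + C) * dist y z < (1 - Real.cos δ) * (2 * dist (p i) z))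
    (hpy : ∀ i, dist y z ≤ τ * dist (p i) z)
    (hS : S * dist x z < (1 - Real.cos δ) * (2 * dist y z)) (hxy : dist x z ≤ dist y z)
    (hbetween : dist y z + (1 - τ) * dist x z ≤ dist y x)
    (hfy : ∀ i, |dist (p i) z - dist (p i) y| ≤ 3 * τ * dist y z)
    (hfx : ∀ i, |dist (p i) z - dist (p i) x| ≤ 3 * τ * dist x z) :
    IsStrainer S C D δ (k + 1) (Fin.snoc p y : Fin (k + 1) → X) z := by
  have hδπ' : δ ≤ Real.pi := by linarith [Real.pi_pos]
  refine ⟨?_, ?_, fun i => ?_, x, ⟨?_, hx, ?_, ?_⟩, fun i => ⟨?_, ?_⟩⟩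
  -- The first entry is the new point `y` only when `k = 0`.
  · cases k with
    | zero => exact hD
    | succ k =>
      rw [← Fin.castSucc_zero, Fin.snoc_castSucc]
      exact hp.1
  · rwa [Fin.init_snoc]
  · rw [Fin.snoc_last, Fin.snoc_castSucc]
    exact errAngle_lt hδ hδπ' (dist_pos.2 (hp.ne i)) (hSC i)
  · rwa [Fin.snoc_last]
  · rw [Fin.snoc_last]
    exact pi_sub_lt_compAngle hδ hδπ' hτ hτ1 hτc hy hx hxy hbetween
  · rw [Fin.snoc_last]
    exact errAngle_lt hδ hδπ' (dist_pos.2 hy) hS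
  · rw [Fin.snoc_last, Fin.snoc_castSucc]
    exact abs_compAngle_sub_lt hδ hδπ hτ1 hτs (hp.ne i) hy (hpy i) (hfy i)
  · rw [Fin.snoc_castSucc]
    exact abs_compAngle_sub_lt hδ hδπ hτ1 hτs (hp.ne i) hx (hxy.trans (hpy i)) (hfx i)

/-! ### Dimension of the strata -/

/-- The set of points with a `(k,δ)`-strainer but no `(k+1,δ)`-strainer has dimension at most
`k`. -/
theorem dimH_strainedSet_diff_le [CompleteSpace X] [TopologicalSpace.SeparableSpace X]
    (hG : IsGeodesicSpace X) (hB : IsBusemannConcave X) {n : ℕ}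
    (hn : dimH (univ : Set X) ≤ (n : ENNReal)) {S C D δ : ℝ} (hS : 0 < S) (hC : 0 ≤ C) (hD : 0 < D)
    (hδ : 0 < δ) (hδπ : δ < Real.pi / 2) (k : ℕ) :
    dimH (strainedSet X S C D k δ \ strainedSet X S C D (k + 1) δ) ≤ (k : ENNReal) := by
  have : SecondCountableTopology X := UniformSpace.secondCountable_of_separable X
  set E := strainedSet X S C D k δ \ strainedSet X S C D (k + 1) δ with hE
  have hsin : 0 < Real.sin δ := Real.sin_pos_of_pos_of_lt_pi hδ (by linarith)
  have hcos : 0 < 1 - Real.cos δ := by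
    have := Real.cos_lt_cos_of_nonneg_of_le_pi le_rfl (by linarith : δ ≤ Real.pi) hδ
    rw [Real.cos_zero] at this
    linarith
  obtain ⟨τ, ⟨⟨hτs, hτc⟩, hτ1⟩, hτ⟩ : ∃ τ : ℝ, ((5 * τ < Real.sin δ ∧ 2 * τ < 1 - Real.cos δ) ∧
      τ < 1) ∧ 0 < τ := by
    have e : ∀ᶠ τ : ℝ in 𝓝 0, (5 * τ < Real.sin δ ∧ 2 * τ < 1 - Real.cos δ) ∧ τ < 1 :=
      ((ContinuousAt.eventually_lt (by fun_prop) (by fun_prop) (by simpa using hsin)).and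
        (ContinuousAt.eventually_lt (by fun_prop) (by fun_prop) (by simpa using hcos))).and
        (eventually_lt_nhds one_pos)
    exact ((e.filter_mono nhdsWithin_le_nhds).and (self_mem_nhdsWithin (s := Ioi 0))).exists
  by_contra! hlt
  obtain ⟨x₀, hx₀, hdim⟩ := exists_mem_nhdsWithin_lt_dimH_of_lt_dimH hlt
  obtain ⟨p, hp⟩ := hx₀.1
  obtain ⟨d, hd, hd0⟩ : ∃ d : ℝ, (∀ i, d < dist (p i) x₀) ∧ 0 < d := by
    have e : ∀ᶠ d : ℝ in 𝓝 0, ∀ i, d < dist (p i) x₀ :=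
      eventually_all.2 fun i => eventually_lt_nhds (dist_pos.2 (hp.ne i))
    exact ((e.filter_mono nhdsWithin_le_nhds).and (self_mem_nhdsWithin (s := Ioi 0))).exists
  have hU : ∀ᶠ z in 𝓝 x₀, IsStrainer S C D δ k p z ∧ ∀ i, d < dist (p i) z :=
    hp.eventually.and (eventually_all.2 fun i =>
      ContinuousAt.eventually_lt (by fun_prop) (by fun_prop) (hd i))
  let V : Set X := E ∩ {z | IsStrainer S C D δ k p z ∧ ∀ i, d < dist (p i) z}
  refine absurd (hdim V (inter_mem self_mem_nhdsWithin (mem_nhdsWithin_of_mem_nhds hU)))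
    (not_lt.2 ?_)
  refine dimH_le_of_expanding_at_points (f := fun z i => dist (p i) z) hτ fun x _ => ?_
  by_contra! hcon
  -- This bounds `dist y z`: `D` for the first entry, `τ * d` for the right angles, and the last
  -- term for the `S + C` error angles.
  set R : ℝ := min (min D (τ * d)) ((1 - Real.cos δ) * (2 * d) / (S + C)) with hR
  have hR0 : 0 < R := by positivity
  have hRD : R ≤ D := (min_le_left _ _).trans (min_le_left _ _)
  have hRτ : R ≤ τ * d := (min_le_left _ _).trans (min_le_right _ _)
  have hRSC : (S + C) * R ≤ (1 - Real.cos δ) * (2 * d) := by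
    rw [mul_comm, ← le_div_iff₀ (by positivity)]
    exact min_le_right _ _
  -- `1 / 2` makes `z` nearer to `x` than to `y`; the other term controls the error angle of the
  -- opposite strainer `x`.
  set c : ℝ := min (1 / 2) ((1 - Real.cos δ) / (2 * S)) with hc
  have hc0 : 0 < c := by positivity
  have hc2 : c ≤ 1 / 2 := min_le_left _ _
  have hcS : S * c < 1 - Real.cos δ := by
    have : c * (2 * S) ≤ 1 - Real.cos δ := (le_div_iff₀ (by positivity)).1 (min_le_right _ _)
    nlinarith
  obtain ⟨y, ⟨hyV, hyR, hyf⟩, z, ⟨hzV, hzR, hzf⟩, hyx, hzx, hzc, hyz⟩ :=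
    exists_almost_between hG hB hn hτ hc0 (x := x)
      (Y := {y | y ∈ V ∧ dist x y < R ∧
        dist (fun i => dist (p i) x) (fun i => dist (p i) y) < τ * dist x y}) fun r hr => by
      obtain ⟨y, hy, hxy, hf⟩ := hcon (min r R) (by positivity)
      refine ⟨y, ⟨hy, hxy.trans_le (min_le_right _ _), hf⟩, ?_, hxy.trans_le (min_le_left _ _)⟩
      rintro rfl
      simp at hf
  have hxz : 0 < dist x z := dist_pos.2 hzx.symm
  have htri : dist x y ≤ dist x z + dist y z := dist_triangle_right x y z
  have hzy : dist x z ≤ dist y z := by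
    have : c * dist x y ≤ 1 / 2 * dist x y := by gcongr
    linarith
  have hyzR : dist y z < R := by nlinarith
  have hy0 : 0 < dist y z := by linarith
  have hcoord : ∀ (w : X) (i : Fin k),
      dist (fun i => dist (p i) x) (fun i => dist (p i) w) < τ * dist x w →
      |dist (p i) x - dist (p i) w| < τ * dist x w := fun w i h =>
    lt_of_le_of_lt (dist_le_pi_dist (fun i => dist (p i) x) (fun i => dist (p i) w) i) h
  refine hzV.1.2 ⟨_, hzV.2.1.snoc (y := y) (x := x) hδ hδπ hτ.le hτ1.le hτs hτc (dist_pos.1 hy0)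
    hzx.symm (by linarith) (fun i => ?_) (fun i => ?_) ?_ hzy ?_ (fun i => ?_) fun i => ?_⟩
  · have := hzV.2.2 i
    calc (S + C) * dist y z ≤ (S + C) * R := by gcongr
      _ ≤ _ := hRSC
      _ < _ := by gcongr
  · have := hzV.2.2 i
    have : τ * d ≤ τ * dist (p i) z := by gcongr
    linarith
  · have h1 : S * dist x z ≤ S * (c * dist x y) := by gcongr
    have h2 : S * c * dist x y ≤ S * c * (2 * dist y z) := by gcongr; linarith
    have h3 : S * c * (2 * dist y z) < (1 - Real.cos δ) * (2 * dist y z) := by gcongr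
    linarith
  · rw [dist_comm y x]; linarith
  · have h1 := hcoord _ i hyf
    have h2 := hcoord _ i hzf
    have h3 := abs_sub_le (dist (p i) z) (dist (p i) x) (dist (p i) y)
    rw [abs_sub_comm (dist (p i) z) (dist (p i) x)] at h3
    -- The 3 comes from `|xz| + |xy| ≤ 2|xz| + |yz| ≤ 3|yz|`.
    have h4 : τ * (dist x z + dist x y) ≤ τ * (3 * dist y z) := by gcongr; linarith
    linarith
  · have h2 := hcoord _ i hzf
    rw [abs_sub_comm]
    have : 0 < τ * dist x z := by positivity
    linarith

/-! ### Partition into strata -/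

theorem strainedSet_succ_subset {S C D δ : ℝ} (k : ℕ) :
    strainedSet X S C D (k + 1) δ ⊆ strainedSet X S C D k δ :=
  fun _ ⟨p, h⟩ => ⟨Fin.init p, h.2.1⟩

theorem strainedSet_antitone {S C D δ : ℝ} : Antitone fun k => strainedSet X S C D k δ :=
  antitone_nat_of_succ_le strainedSet_succ_subset

theorem disjoint_stratum {S C D δ : ℝ} {n : ℕ} {j k : Fin (n + 1)} (hjk : j < k) :
    Disjoint (stratum X S C D n δ j) (stratum X S C D n δ k) := by
  have hj : (j : ℕ) < n := by omega
  refine Set.disjoint_left.2 fun x hx hx' => ?_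
  rw [stratum, if_pos hj] at hx
  refine hx.2 (strainedSet_antitone (show (j : ℕ) + 1 ≤ k by omega) ?_)
  rw [stratum] at hx'
  split_ifs at hx' with h
  · exact hx'.1
  · rwa [show (k : ℕ) = n by omega]

theorem iUnion_stratum {S C D δ : ℝ} {n : ℕ} : ⋃ k, stratum X S C D n δ k = univ := by
  refine eq_univ_of_forall fun x => ?_
  have h0 : x ∈ strainedSet X S C D 0 δ := ⟨Fin.elim0, trivial⟩
  classical
  -- The stratum of `x` is given by the longest strainer at `x`, capped at `n`.
  let m := Nat.findGreatest (fun k => x ∈ strainedSet X S C D k δ) n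
  have hm : x ∈ strainedSet X S C D m δ :=
    Nat.findGreatest_spec (P := fun k => x ∈ strainedSet X S C D k δ) n.zero_le h0
  have hmn : m ≤ n := Nat.findGreatest_le n
  refine mem_iUnion.2 ⟨⟨m, by omega⟩, ?_⟩
  rw [stratum]
  split_ifs with h
  · exact ⟨hm, Nat.findGreatest_is_greatest (Nat.lt_succ_self m) h⟩
  · rwa [← show m = n from le_antisymm hmn (not_lt.1 h)]

theorem strainerThreshold_succ_le (n : ℕ) : strainerThreshold (n + 1) ≤ 1 := by
  rw [strainerThreshold]
  refine div_le_one_of_le₀ ?_ (by positivity)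
  have : (1 : ℝ) ≤ 2 ^ (2 * (n + 1) + 1) := one_le_pow₀ (by norm_num)
  push_cast
  nlinarith [(Nat.cast_nonneg n : (0 : ℝ) ≤ n)]

end BusemannConcave

theorem mainTheorem8 (δ : ℝ) (hδ : 0 < δ) :
    ∃ S₁ : ℝ, 1 < S₁ ∧
      ∀ n : ℕ, δ < BusemannConcave.strainerThreshold (n + 1) →
      ∀ (X : Type*) [MetricSpace X] [CompleteSpace X] [TopologicalSpace.SeparableSpace X]
        (S C D : ℝ), 1 ≤ S → S ≤ S₁ → 0 ≤ C → 0 < D →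
        BusemannConcave.IsGeodesicSpace X →
        BusemannConcave.IsSConcave X S →
        BusemannConcave.IsLocallySemiConvex X C D →
        BusemannConcave.IsBusemannConcave X →
        dimH (Set.univ : Set X) = (n : ENNReal) →
        (⋃ k : Fin (n + 1), BusemannConcave.stratum X S C D n δ k) = Set.univ ∧
        Pairwise (fun j k : Fin (n + 1) =>
          Disjoint (BusemannConcave.stratum X S C D n δ j)
            (BusemannConcave.stratum X S C D n δ k)) ∧
        ∀ k : Fin (n + 1),
          dimH (BusemannConcave.stratum X S C D n δ k) ≤ ((k : ℕ) : ENNReal) := by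
  -- The dimension estimate holds for every positive `S`, so any number above 1 serves.
  refine ⟨2, one_lt_two, ?_⟩
  intro n hδn X _ _ _ S C D hS _ hC hD hG _ _ hB hn
  refine ⟨BusemannConcave.iUnion_stratum, fun j k hjk => ?_, fun k => ?_⟩
  · rcases lt_or_gt_of_ne hjk with h | h
    · exact BusemannConcave.disjoint_stratum h
    · exact (BusemannConcave.disjoint_stratum h).symm
  · have hδπ : δ < Real.pi / 2 := by
      linarith [BusemannConcave.strainerThreshold_succ_le n, Real.pi_gt_three]
    rw [BusemannConcave.stratum]
    split_ifs with h
    · exact BusemannConcave.dimH_strainedSet_diff_le hG hB hn.le (by linarith) hC hD hδ hδπ k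
    · rw [show (k : ℕ) = n by omega, ← hn]
      exact dimH_mono (subset_univ _)
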